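/- Let $T$ be a finite set of $n$ targets and $D$ a disjoint finite set of $k\ge 1$ depots. Let $G=(V,E)$ be the undirected graph with $V=T\cup D$ in which two distinct vertices are adjacent exactly when at least one of them is a target (so $|E|=\binom n2+nk$), and let $C_1,\dots,C_m$ be a partition of $T$ into non-empty sets (clusters). For $S\subseteq V$ let $\gamma(S)$ be the set of edges with both ends in $S$ and $\delta(S)$ the set of edges with exactly one end in $S$; for disjoint $A,B\subseteq V$ let $(A:B)$ be the set of edges with one end in $A$ and the other in $B$; and for $\mathbf x\in\mathbb R^{E}$, $A'\subseteq E$ put $x(A')=\sum_{e\in A'}x_e$ and $x(A:B)=x((A:B))$. A vector $(\mathbf x,\mathbf y)\in\mathbb R^{E}\times\mathbb R^{T}$ is a feasible GMDTSP solution if 1. $x(\delta(\{i\}))=2y_i$ for all $i\in T$; 2. $\sum_{i\in C_h}y_i\ge 1$ for $h=1,\dots,m$; 3. $x(\delta(S))\ge 2y_i$ for all $S\subseteq T$ and $i\in S$; 4. $x(D':\{j\})+3x_{jl}+x(\{l\}:D\setminus D')\le 2(y_j+y_l)$ for all distinct $j,l\in T$ and all $D'\subseteq D$; 5. $x(D':\{j\})+2x(\gamma(S\cup\{j,l\}))+x(\{l\}:D\setminus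 D')\le \sum_{v\in S}2y_v+2(y_j+y_l)-y_i$ for all distinct $j,l\in T$, all non-empty $S\subseteq T\setminus\{j,l\}$, all $i\in S$ and all $D'\subseteq D$; 6. $x_e\in\{0,1\}$ for $e\in\gamma(T)$, $x_e\in\{0,1,2\}$ for $e\in(D:T)$, and $y_i\in\{0,1\}$ for $i\in T$. Let $P$ be the convex hull of all feasible GMDTSP solutions, for $F\subseteq T$ let $P(F)=\{(\mathbf x,\mathbf y)\in P: y_v=1\text{ for all }v\in F\}$, and let $W$ be the set of targets whose cluster is a singleton. Then for every $F\subseteq T$, $$\dim P(F)=\binom n2+nk-|F\cup W|,$$ where $\dim$ denotes the dimension of the affine hull (and $\dim\emptyset=-1$). -/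

import Mathlib

namespace GMDTSP

/-- The graph on the vertex set `T ⊕ D` (targets and depots) in which two distinct vertices are
adjacent exactly when at least one of them is a target. -/
def graph (T D : Type*) : SimpleGraph (T ⊕ D) where
  Adj u v := u ≠ v ∧ (u.isLeft ∨ v.isLeft)
  symm := ⟨fun _ _ h => ⟨h.1.symm, h.2.symm⟩⟩
  loopless := ⟨fun _ h => h.1 rfl⟩

instance (T D : Type*) [DecidableEq T] [DecidableEq D] : DecidableRel (graph T D).Adj :=
  fun u v => inferInstanceAs (Decidable (u ≠ v ∧ (u.isLeft ∨ v.isLeft)))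

/-- The edge set `E`, as a type. -/
abbrev Edge (T D : Type*) : Type _ := (graph T D).edgeSet

section

variable {T D : Type*} [Fintype T] [DecidableEq T] [Fintype D] [DecidableEq D]

/-- A set of targets, as a set of vertices. -/
def ofTargets (S : Finset T) : Finset (T ⊕ D) := S.map Function.Embedding.inl

/-- A set of depots, as a set of vertices. -/
def ofDepots (S : Finset D) : Finset (T ⊕ D) := S.map Function.Embedding.inr

/-- `γ(S)`: the edges with both ends in `S`. -/
def gamma (S : Finset (T ⊕ D)) : Finset (Edge T D) :=
  Finset.univ.filter fun e => ∀ v ∈ (e : Sym2 (T ⊕ D)), v ∈ S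

/-- `(A : B)`: the edges with one end in `A` and the other in `B` (used for disjoint `A`, `B`). -/
def between (A B : Finset (T ⊕ D)) : Finset (Edge T D) :=
  Finset.univ.filter fun e => ∃ i ∈ A, ∃ j ∈ B, (e : Sym2 (T ⊕ D)) = s(i, j)

/-- `δ(S)`: the edges with one end in `S` and the other outside `S`. -/
def delta (S : Finset (T ⊕ D)) : Finset (Edge T D) := between S Sᶜ

/-- `x(A) = ∑ e ∈ A, x e`. -/
noncomputable def total (x : Edge T D → ℝ) (A : Finset (Edge T D)) : ℝ := ∑ e ∈ A, x e

/-- `(x, y)` is a feasible solution of the integer program, for the clusters that are the parts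
of `C`. -/
structure Feasible (C : Finpartition (Finset.univ : Finset T))
    (x : Edge T D → ℝ) (y : T → ℝ) : Prop where
  degree : ∀ i : T, total x (delta {Sum.inl i}) = 2 * y i
  assignment : ∀ c ∈ C.parts, 1 ≤ ∑ i ∈ c, y i
  subtour : ∀ S : Finset T, ∀ i ∈ S, 2 * y i ≤ total x (delta (ofTargets S))
  fourPath : ∀ j k : T, j ≠ k → ∀ D' : Finset D,
    total x (between (ofDepots D') {Sum.inl j})
      + 3 * total x (between {Sum.inl j} {Sum.inl k})
      + total x (between {Sum.inl k} (ofDepots D'ᶜ)) ≤ 2 * (y j + y k)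
  path : ∀ j k : T, j ≠ k → ∀ S : Finset T, j ∉ S → k ∉ S → ∀ i ∈ S, ∀ D' : Finset D,
    total x (between (ofDepots D') {Sum.inl j})
      + 2 * total x (gamma (ofTargets (S ∪ {j, k})))
      + total x (between {Sum.inl k} (ofDepots D'ᶜ))
        ≤ ∑ v ∈ S, 2 * y v + 2 * (y j + y k) - y i
  integer_target : ∀ e ∈ gamma (ofTargets (Finset.univ : Finset T)), x e = 0 ∨ x e = 1
  integer_depot : ∀ e ∈ between (ofDepots (Finset.univ : Finset D)) (ofTargets Finset.univ),
    x e = 0 ∨ x e = 1 ∨ x e = 2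
  integer_visit : ∀ i : T, y i = 0 ∨ y i = 1

/-- The polytope `P`: the convex hull of the feasible solutions. -/
def P (D : Type*) [Fintype D] [DecidableEq D] (C : Finpartition (Finset.univ : Finset T)) :
    Set ((Edge T D → ℝ) × (T → ℝ)) :=
  convexHull ℝ {p | Feasible C p.1 p.2}

/-- The polytope `P(F)`. -/
def PF (D : Type*) [Fintype D] [DecidableEq D] (C : Finpartition (Finset.univ : Finset T))
    (F : Finset T) : Set ((Edge T D → ℝ) × (T → ℝ)) :=
  {p | p ∈ P D C ∧ ∀ v ∈ F, p.2 v = 1}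

/-- `W`: the targets whose cluster is a singleton. -/
def W (C : Finpartition (Finset.univ : Finset T)) : Finset T :=
  Finset.univ.filter fun v => (C.part v).card = 1

end

open Classical in
/-- The dimension of a set: that of its affine hull, and `-1` for the empty set. -/
noncomputable def dim {M : Type*} [AddCommGroup M] [Module ℝ M] (s : Set M) : ℤ :=
  if s = ∅ then -1 else (Module.finrank ℝ (affineSpan ℝ s).direction : ℤ)

end GMDTSP

/-! The degree equations and `y v = 1` for `v ∈ F ∪ W C` hold on `PF D C F`: a singleton cluster
forces its target to be visited. They are independent (`system_surjective`), so the upper bound on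
the dimension is `|E| + n - n - |F ∪ W C|`. For the lower bound, fix a depot `d₀`. A solution of the
homogeneous system is a combination of the vectors `exchange d₀ e` and, for `v ∉ F ∪ W C`, of "visit
`v` by a double edge to `d₀`" (`eq_sum_exchange`). Each is a multiple of a difference of two
feasible points: start with every target on its own double edge to `d₀`, then move one double edge
to another depot, merge two targets into one tour through `d₀`, or drop a target. -/

namespace GMDTSP

section

variable {T D : Type*}

/-- The edge joining a target and a depot. -/
def depotEdge (v : T) (d : D) : Edge T D :=
  ⟨s(Sum.inl v, Sum.inr d), by simp [graph]⟩

/-- The edge joining two distinct targets. -/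
def targetEdge {i j : T} (h : i ≠ j) : Edge T D :=
  ⟨s(Sum.inl i, Sum.inl j), by simp [graph, h]⟩

theorem edge_cases (e : Edge T D) :
    (∃ v d, e = depotEdge v d) ∨ ∃ (i j : T) (h : i ≠ j), e = targetEdge h := by
  obtain ⟨e, he⟩ := e
  induction e using Sym2.inductionOn with
  | hf a b =>
    rcases a with a | a <;> rcases b with b | b
    · right
      have h : a ≠ b := by simpa [graph] using he
      exact ⟨a, b, h, rfl⟩
    · exact Or.inl ⟨a, b, rfl⟩
    · exact Or.inl ⟨b, a, Subtype.ext Sym2.eq_swap⟩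
    · simp [graph] at he

@[simp] theorem inl_mem_depotEdge {i v : T} {d : D} :
    Sum.inl i ∈ (depotEdge v d : Sym2 (T ⊕ D)) ↔ i = v := by
  simp [depotEdge]

@[simp] theorem inl_mem_targetEdge {v i j : T} (h : i ≠ j) :
    Sum.inl v ∈ (targetEdge (D := D) h : Sym2 (T ⊕ D)) ↔ v = i ∨ v = j := by
  simp [targetEdge]

@[simp] theorem depotEdge_inj {v v' : T} {d d' : D} :
    depotEdge v d = depotEdge v' d' ↔ v = v' ∧ d = d' := by
  simp [depotEdge, Subtype.ext_iff]

@[simp] theorem targetEdge_ne_depotEdge {i j v : T} (h : i ≠ j) (d : D) :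
    targetEdge h ≠ depotEdge v d := by
  simp [depotEdge, targetEdge, Subtype.ext_iff]

@[simp] theorem depotEdge_ne_targetEdge {i j v : T} (h : i ≠ j) (d : D) :
    depotEdge v d ≠ targetEdge h := (targetEdge_ne_depotEdge h d).symm

/-! ### Sums over edge sets -/

theorem total_mono {x : Edge T D → ℝ} (hx : ∀ e, 0 ≤ x e) {A B : Finset (Edge T D)}
    (h : A ⊆ B) : total x A ≤ total x B :=
  Finset.sum_le_sum_of_subset_of_nonneg h fun e _ _ => hx e

theorem total_add (x z : Edge T D → ℝ) (A : Finset (Edge T D)) :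
    total (x + z) A = total x A + total z A := Finset.sum_add_distrib

theorem total_sub (x z : Edge T D → ℝ) (A : Finset (Edge T D)) :
    total (x - z) A = total x A - total z A := Finset.sum_sub_distrib _ _

theorem total_smul (c : ℝ) (x : Edge T D → ℝ) (A : Finset (Edge T D)) :
    total (c • x) A = c * total x A := (Finset.mul_sum _ _ _).symm

theorem total_sum {ι : Type*} (s : Finset ι) (x : ι → Edge T D → ℝ) (A : Finset (Edge T D)) :
    total (∑ i ∈ s, x i) A = ∑ i ∈ s, total (x i) A := by
  simp only [total, Finset.sum_apply]
  exact Finset.sum_comm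

variable [DecidableEq T] [DecidableEq D]

theorem total_single (e : Edge T D) (c : ℝ) (A : Finset (Edge T D)) :
    total (Pi.single e c) A = if e ∈ A then c else 0 := by
  simp [total, Pi.single_apply]

variable [Fintype T]

/-- The edge vector in which each target `v` is joined to the depot `f v` with
multiplicity `2 * y v`. -/
noncomputable def loops (y : T → ℝ) (f : T → D) : Edge T D → ℝ :=
  ∑ v, Pi.single (depotEdge v (f v)) (2 * y v)

@[simp] theorem loops_targetEdge (y : T → ℝ) (f : T → D) {i j : T} (h : i ≠ j) :
    loops y f (targetEdge h) = 0 := by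
  simp [loops]

@[simp] theorem loops_depotEdge (y : T → ℝ) (f : T → D) (v : T) (d : D) :
    loops y f (depotEdge v d) = if d = f v then 2 * y v else 0 := by
  simp only [loops, Finset.sum_apply, Pi.single_apply, depotEdge_inj, ite_and]
  simp

/-- The change of an edge vector when the edge `e` is used once and each target on it uses its edge
to the depot `d₀` once less. -/
noncomputable def exchange (d₀ : D) (e : Edge T D) : Edge T D → ℝ :=
  Pi.single e 1 - ∑ v : T, if Sum.inl v ∈ (e : Sym2 (T ⊕ D)) then
    Pi.single (depotEdge v d₀) 1 else 0

theorem exchange_depotEdge (d₀ : D) (v : T) (d : D) :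
    exchange d₀ (depotEdge v d) = Pi.single (depotEdge v d) 1 - Pi.single (depotEdge v d₀) 1 := by
  simp [exchange]

theorem exchange_targetEdge (d₀ : D) {i j : T} (h : i ≠ j) :
    exchange d₀ (targetEdge h) = Pi.single (targetEdge h) 1 -
      (Pi.single (depotEdge i d₀) 1 + Pi.single (depotEdge j d₀) 1) := by
  have h3 (v : T) : (if v = i ∨ v = j then (Pi.single (depotEdge v d₀) 1 : Edge T D → ℝ) else 0) =
      (if v = i then Pi.single (depotEdge v d₀) 1 else 0) +
        if v = j then Pi.single (depotEdge v d₀) 1 else 0 := by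
    grind
  simp [exchange, h3, Finset.sum_add_distrib]

/-! ### Membership in the edge sets of the constraints -/

variable [Fintype D]

theorem mem_delta_singleton {e : Edge T D} {i : T} :
    e ∈ delta {Sum.inl i} ↔ Sum.inl i ∈ (e : Sym2 (T ⊕ D)) := by
  rcases edge_cases e with ⟨v, d, rfl⟩ | ⟨a, b, h, rfl⟩
  · simp [delta, between, depotEdge]
    grind
  · simp only [delta, between, Finset.mem_filter, Finset.mem_univ, true_and, Finset.mem_singleton,
      exists_eq_left, Finset.mem_compl, inl_mem_targetEdge]
    constructor
    · rintro ⟨u, -, hu⟩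
      rw [← inl_mem_targetEdge (D := D) h, hu]
      simp
    · rintro (rfl | rfl)
      · exact ⟨Sum.inl b, by simpa using h.symm, rfl⟩
      · exact ⟨Sum.inl a, by simpa using h, Sym2.eq_swap⟩

theorem between_subset_delta (A : Finset (T ⊕ D)) (i : T) :
    between A {Sum.inl i} ⊆ delta {Sum.inl i} := by
  intro e he
  rw [mem_delta_singleton]
  simp only [between, Finset.mem_filter, Finset.mem_singleton] at he
  obtain ⟨-, a, -, b, rfl, he⟩ := he
  simp [he]

theorem between_comm (A B : Finset (T ⊕ D)) : between A B = between B A := by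
  ext e
  simp only [between, Finset.mem_filter, Finset.mem_univ, true_and]
  constructor <;> rintro ⟨a, ha, b, hb, h⟩ <;> exact ⟨b, hb, a, ha, h.trans Sym2.eq_swap⟩

@[simp] theorem depotEdge_notMem_gamma (v : T) (d : D) (S : Finset T) :
    depotEdge v d ∉ gamma (ofTargets S) := by
  simp [gamma, depotEdge, ofTargets]

@[simp] theorem targetEdge_mem_gamma {i j : T} (h : i ≠ j) (S : Finset T) :
    targetEdge (D := D) h ∈ gamma (ofTargets S) ↔ i ∈ S ∧ j ∈ S := by
  simp [gamma, targetEdge, ofTargets]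

@[simp] theorem depotEdge_mem_delta (v : T) (d : D) (S : Finset T) :
    depotEdge v d ∈ delta (ofTargets S) ↔ v ∈ S := by
  simp [delta, between, depotEdge, ofTargets]

@[simp] theorem targetEdge_mem_delta {i j : T} (h : i ≠ j) (S : Finset T) :
    targetEdge (D := D) h ∈ delta (ofTargets S) ↔ (i ∈ S ∧ j ∉ S) ∨ (j ∈ S ∧ i ∉ S) := by
  simp [delta, between, targetEdge, ofTargets]
  grind

@[simp] theorem depotEdge_mem_between (v j : T) (d : D) (S : Finset D) :
    depotEdge v d ∈ between (ofDepots S) {Sum.inl j} ↔ v = j ∧ d ∈ S := by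
  simp [between, depotEdge, ofDepots]
  grind

@[simp] theorem targetEdge_notMem_between {a b : T} (h : a ≠ b) (B : Finset (T ⊕ D))
    (S : Finset D) : targetEdge h ∉ between (ofDepots S) B := by
  simp [between, targetEdge, ofDepots]

theorem between_inl_inl {j k : T} (h : j ≠ k) :
    between {Sum.inl j} {Sum.inl k} = {targetEdge (D := D) h} := by
  ext e
  simp [between, targetEdge, Subtype.ext_iff]

/-! ### Counting edges and degrees. -/

/-- Handshake lemma: targets have degree `n + k - 1`, depots have degree `n`. -/
theorem card_edge :
    (Fintype.card (Edge T D) : ℤ) =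
      ((Fintype.card T).choose 2 : ℤ) + (Fintype.card T : ℤ) * (Fintype.card D : ℤ) := by
  have hl (v : T) : (graph T D).degree (Sum.inl v) + 1 = Fintype.card T + Fintype.card D := by
    have h : (graph T D).neighborFinset (Sum.inl v) = Finset.univ.erase (Sum.inl v) := by
      ext u
      rw [SimpleGraph.mem_neighborFinset]
      simp [graph, ne_comm]
    rw [← SimpleGraph.card_neighborFinset_eq_degree, h, ← Fintype.card_sum,
      Finset.card_erase_add_one (Finset.mem_univ _), Finset.card_univ]
  have hr (d : D) : (graph T D).degree (Sum.inr d) = Fintype.card T := by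
    have h : (graph T D).neighborFinset (Sum.inr d) = ofTargets Finset.univ := by
      ext u
      rw [SimpleGraph.mem_neighborFinset]
      rcases u with u | u <;> simp [graph, ofTargets]
    rw [← SimpleGraph.card_neighborFinset_eq_degree, h, ofTargets, Finset.card_map,
      Finset.card_univ]
  have hs := (graph T D).sum_degrees_eq_twice_card_edges
  rw [Fintype.sum_sum_type, SimpleGraph.edgeFinset_card] at hs
  have h1 : (∑ v : T, ((graph T D).degree (Sum.inl v) : ℤ)) =
      Fintype.card T * (Fintype.card T + Fintype.card D - 1) := by
    rw [Finset.sum_congr rfl fun v _ => show ((graph T D).degree (Sum.inl v) : ℤ) =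
      Fintype.card T + Fintype.card D - 1 by have := hl v; omega]
    rw [Finset.sum_const, Finset.card_univ, nsmul_eq_mul]
  have h2 : (∑ d : D, ((graph T D).degree (Sum.inr d) : ℤ)) =
      Fintype.card D * Fintype.card T := by
    simp [hr]
  have h3 : (2 * (Fintype.card T).choose 2 : ℤ) = Fintype.card T * (Fintype.card T - 1) := by
    rcases Nat.eq_zero_or_pos (Fintype.card T) with h | h
    · simp [h]
    · have := Nat.choose_two_right (Fintype.card T)
      have h4 := Nat.div_mul_cancel (Nat.even_mul_pred_self (Fintype.card T)).two_dvd
      rw [← this] at h4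
      zify [h] at h4
      linarith
  have hs' : (∑ v : T, ((graph T D).degree (Sum.inl v) : ℤ)) +
      ∑ d : D, ((graph T D).degree (Sum.inr d) : ℤ) = 2 * Fintype.card (Edge T D) := by
    exact_mod_cast hs
  rw [h1, h2] at hs'
  linarith

/-- Double counting: an edge inside `S` is seen from both ends, an edge leaving `S` from one. With
the degree equations this yields the subtour inequalities. -/
theorem sum_total_delta_le {x : Edge T D → ℝ} (hx : ∀ e, 0 ≤ x e) (S : Finset T) :
    ∑ v ∈ S, total x (delta {Sum.inl v}) ≤
      total x (delta (ofTargets S)) + 2 * total x (gamma (ofTargets S)) := by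
  have h1 : ∑ v ∈ S, total x (delta {Sum.inl v}) =
      ∑ e : Edge T D, ∑ v ∈ S, if Sum.inl v ∈ (e : Sym2 (T ⊕ D)) then x e else 0 := by
    rw [Finset.sum_comm]
    refine Finset.sum_congr rfl fun v _ => ?_
    rw [← Finset.sum_filter, total]
    congr 1
    ext e
    simp [mem_delta_singleton]
  have h2 (A : Finset (Edge T D)) : total x A = ∑ e, if e ∈ A then x e else 0 := by
    simp [total]
  rw [h1, h2, h2, Finset.mul_sum, ← Finset.sum_add_distrib]
  refine Finset.sum_le_sum fun e _ => ?_
  have := hx e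
  rcases edge_cases e with ⟨v, d, rfl⟩ | ⟨i, j, h, rfl⟩
  · simp
  · have h3 (v : T) : (if v = i ∨ v = j then x (targetEdge h) else 0) =
        (if v = i then x (targetEdge h) else 0) + if v = j then x (targetEdge h) else 0 := by
      grind
    simp only [inl_mem_targetEdge, h3, Finset.sum_add_distrib, Finset.sum_ite_eq',
      targetEdge_mem_delta, targetEdge_mem_gamma]
    by_cases hi : i ∈ S <;> by_cases hj : j ∈ S <;> simp [hi, hj]
    linarith

/-! ### Feasible solutions -/

theorem total_between_le {x : Edge T D → ℝ} {y : T → ℝ} (hx : ∀ e, 0 ≤ x e)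
    (degree : ∀ i : T, total x (delta {Sum.inl i}) = 2 * y i) (S : Finset D) (j : T) :
    total x (between (ofDepots S) {Sum.inl j}) ≤ 2 * y j := by
  rw [← degree]
  exact total_mono hx (between_subset_delta _ _)

/-- Without target edges every `γ` term vanishes and the degree equations bound each depot term by
`2 * y`, so the path inequalities have slack. -/
theorem Feasible.of_no_targetEdge {C : Finpartition (Finset.univ : Finset T)}
    {x : Edge T D → ℝ} {y : T → ℝ} (hx : ∀ e, 0 ≤ x e)
    (degree : ∀ i : T, total x (delta {Sum.inl i}) = 2 * y i)
    (assignment : ∀ c ∈ C.parts, 1 ≤ ∑ i ∈ c, y i)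
    (target : ∀ (i j : T) (h : i ≠ j), x (targetEdge h) = 0)
    (depot : ∀ v d, x (depotEdge v d) = 0 ∨ x (depotEdge v d) = 1 ∨ x (depotEdge v d) = 2)
    (visit : ∀ i : T, y i = 0 ∨ y i = 1) : Feasible C x y := by
  have hy (i : T) : 0 ≤ y i := by rcases visit i with h | h <;> simp [h]
  have hγ (S : Finset T) : total x (gamma (ofTargets S)) = 0 := by
    refine Finset.sum_eq_zero fun e he => ?_
    rcases edge_cases e with ⟨v, d, rfl⟩ | ⟨i, j, h, rfl⟩
    · simp at he
    · exact target i j h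
  have hb := total_between_le hx degree
  refine ⟨degree, assignment, fun S i hi => ?_, fun j k hjk D' => ?_,
    fun j k hjk S hj hk i hi D' => ?_, fun e he => ?_, fun e he => ?_, visit⟩
  · have h := sum_total_delta_le hx S
    simp only [degree, hγ] at h
    have := Finset.single_le_sum (f := fun v => 2 * y v) (fun v _ => by linarith [hy v]) hi
    linarith
  · rw [between_inl_inl hjk, between_comm {Sum.inl k}]
    have : total x {targetEdge hjk} = 0 := by simp [total, target]
    linarith [hb D' j, hb D'ᶜ k]
  · rw [hγ, between_comm {Sum.inl k}]
    have := Finset.single_le_sum (f := fun v => 2 * y v) (fun v _ => by linarith [hy v]) hi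
    linarith [hb D' j, hb D'ᶜ k, hy i]
  · rcases edge_cases e with ⟨v, d, rfl⟩ | ⟨i, j, h, rfl⟩
    · simp at he
    · exact Or.inl (target i j h)
  · rcases edge_cases e with ⟨v, d, rfl⟩ | ⟨i, j, h, rfl⟩
    · exact depot v d
    · simp at he

/-- The only delicate inequalities are those involving the tour `d₀, a, b, d₀`; every `γ` term is 0
or 1, and the depot terms at `a` and `b` are at most 1. -/
theorem Feasible.of_one_targetEdge {C : Finpartition (Finset.univ : Finset T)}
    {x : Edge T D → ℝ} {a b : T} (hab : a ≠ b) (d₀ : D) (hx : ∀ e, 0 ≤ x e)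
    (degree : ∀ i : T, total x (delta {Sum.inl i}) = 2)
    (edge : x (targetEdge hab) = 1)
    (target : ∀ (i j : T) (h : i ≠ j), targetEdge (D := D) h ≠ targetEdge hab →
      x (targetEdge h) = 0)
    (depot : ∀ v d, x (depotEdge v d) = 0 ∨ x (depotEdge v d) = 1 ∨ x (depotEdge v d) = 2)
    (ha : ∀ d, x (depotEdge a d) = if d = d₀ then 1 else 0)
    (hb : ∀ d, x (depotEdge b d) = if d = d₀ then 1 else 0) : Feasible C x 1 := by
  have hle := total_between_le (y := 1) hx (by simpa using degree)
  simp only [Pi.one_apply, mul_one] at hle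
  have hγ (S : Finset T) : total x (gamma (ofTargets S)) = if a ∈ S ∧ b ∈ S then 1 else 0 := by
    rw [if_congr (targetEdge_mem_gamma (D := D) hab S).symm edge.symm rfl,
      ← Finset.sum_ite_eq' (gamma (ofTargets S)) (targetEdge hab) x]
    refine Finset.sum_congr rfl fun e he => ?_
    rcases edge_cases e with ⟨v, d, rfl⟩ | ⟨i, j, h, rfl⟩
    · simp at he
    · split_ifs with h'
      · rfl
      · exact target i j h h'
  have hend (v : T) (hv : v = a ∨ v = b) (S : Finset D) :
      total x (between (ofDepots S) {Sum.inl v}) = if d₀ ∈ S then 1 else 0 := by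
    have hv' : ∀ d, x (depotEdge v d) = if d = d₀ then 1 else 0 := by
      rcases hv with rfl | rfl <;> assumption
    have h1 : x (depotEdge v d₀) = 1 := by simp [hv']
    have h2 : d₀ ∈ S ↔ depotEdge v d₀ ∈ between (ofDepots S) {Sum.inl v} := by simp
    rw [if_congr h2 h1.symm rfl, ← Finset.sum_ite_eq' _ (depotEdge v d₀) x]
    refine Finset.sum_congr rfl fun e he => ?_
    rcases edge_cases e with ⟨w, d, rfl⟩ | ⟨i, j, h, rfl⟩
    · simp only [depotEdge_mem_between] at he
      obtain ⟨rfl, -⟩ := he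
      by_cases hd : d = d₀ <;> simp [hv', hd]
    · simp at he
  have hcard (S : Finset T) {i : T} (hi : i ∈ S) : (1 : ℝ) ≤ S.card :=
    by exact_mod_cast Finset.card_pos.mpr ⟨i, hi⟩
  have hcard2 (S : Finset T) (ha : a ∈ S) (hb : b ∈ S) : (2 : ℝ) ≤ S.card := by
    exact_mod_cast Finset.one_lt_card.mpr ⟨a, ha, b, hb, hab⟩
  refine ⟨by simpa using degree, fun c hc => ?_, fun S i hi => ?_, fun j k hjk D' => ?_,
    fun j k hjk S hj hk i hi D' => ?_, fun e he => ?_, fun e he => ?_, fun i => Or.inr rfl⟩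
  · obtain ⟨i, hi⟩ := C.nonempty_of_mem_parts hc
    simpa using hcard c hi
  · have h := sum_total_delta_le hx S
    simp only [degree, hγ, Finset.sum_const, nsmul_eq_mul] at h
    simp only [Pi.one_apply]
    split_ifs at h with h'
    · linarith [hcard2 S h'.1 h'.2]
    · linarith [hcard S hi]
  · rw [between_inl_inl hjk, between_comm {Sum.inl k}]
    have htot : total x {targetEdge hjk} = x (targetEdge hjk) := by simp [total]
    simp only [Pi.one_apply, htot]
    by_cases h : targetEdge (D := D) hjk = targetEdge hab
    · have hj : j = a ∨ j = b := by
        rw [← inl_mem_targetEdge (D := D) hab, ← h]; simp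
      have hk : k = a ∨ k = b := by
        rw [← inl_mem_targetEdge (D := D) hab, ← h]; simp
      rw [hend j hj, hend k hk, h, edge]
      -- `d₀` lies in exactly one of `D'` and its complement, so the left side is `3 + 1`: the
      -- inequality is tight.
      by_cases hd : d₀ ∈ D' <;> simp [hd] <;> norm_num
    · rw [target j k hjk h]
      linarith [hle D' j, hle D'ᶜ k]
  · rw [between_comm {Sum.inl k}, hγ]
    simp only [Pi.one_apply, Finset.sum_const, nsmul_eq_mul]
    have h1 := hcard S hi
    have hend' (v : T) (hv : v = a ∨ v = b) (S : Finset D) :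
        total x (between (ofDepots S) {Sum.inl v}) ≤ 1 := by
      rw [hend v hv]; split_ifs <;> norm_num
    split_ifs with h
    · by_cases hja : j = a ∨ j = b
      · by_cases hka : k = a ∨ k = b
        · linarith [hend' j hja D', hend' k hka D'ᶜ]
        · linarith [hend' j hja D', hle D'ᶜ k]
      · by_cases hka : k = a ∨ k = b
        · linarith [hle D' j, hend' k hka D'ᶜ]
        -- Both depot terms may now be 2, but `a` and `b` lie in `S`, so the right side is at least
        -- 7 against 6.
        · have := hcard2 S (by grind) (by grind)
          linarith [hle D' j, hle D'ᶜ k]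
    · linarith [hle D' j, hle D'ᶜ k]
  · rcases edge_cases e with ⟨v, d, rfl⟩ | ⟨i, j, h, rfl⟩
    · simp at he
    · by_cases h' : targetEdge (D := D) h = targetEdge hab
      · rw [h', edge]; simp
      · exact Or.inl (target i j h h')
  · rcases edge_cases e with ⟨v, d, rfl⟩ | ⟨i, j, h, rfl⟩
    · exact depot v d
    · simp at he

theorem total_loops (y : T → ℝ) (f : T → D) (i : T) :
    total (loops y f) (delta {Sum.inl i}) = 2 * y i := by
  simp [loops, total_sum, total_single, mem_delta_singleton]

theorem feasible_loops {C : Finpartition (Finset.univ : Finset T)} {y : T → ℝ} (f : T → D)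
    (assignment : ∀ c ∈ C.parts, 1 ≤ ∑ i ∈ c, y i)
    (visit : ∀ i : T, y i = 0 ∨ y i = 1) : Feasible C (loops y f) y := by
  refine .of_no_targetEdge (fun e => ?_) (total_loops y f) assignment
    (fun i j h => loops_targetEdge y f h) (fun v d => ?_) visit
  · rcases edge_cases e with ⟨v, d, rfl⟩ | ⟨i, j, h, rfl⟩
    · rcases visit v with h | h <;> simp [h]
      split_ifs <;> norm_num
    · simp
  · rcases visit v with h | h <;> by_cases hd : d = f v <;> simp [h, hd]

theorem total_exchange (d₀ : D) (e : Edge T D) (i : T) :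
    total (exchange d₀ e) (delta {Sum.inl i}) = 0 := by
  rcases edge_cases e with ⟨v, d, rfl⟩ | ⟨a, b, h, rfl⟩
  · simp [exchange_depotEdge, total_sub, total_single, mem_delta_singleton]
  · simp only [exchange_targetEdge, total_sub, total_add, total_single, mem_delta_singleton,
      inl_mem_depotEdge, inl_mem_targetEdge]
    grind

theorem feasible_targetEdge (C : Finpartition (Finset.univ : Finset T)) (d₀ : D) {a b : T}
    (h : a ≠ b) :
    Feasible C (loops 1 (fun _ => d₀) + exchange d₀ (targetEdge h)) 1 := by
  have hd (v : T) (d : D) :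
      (loops 1 (fun _ => d₀) + exchange d₀ (targetEdge h) : Edge T D → ℝ) (depotEdge v d) =
      if d = d₀ then (if v = a ∨ v = b then 1 else 2) else 0 := by
    simp only [exchange_targetEdge, Pi.add_apply, Pi.sub_apply, loops_depotEdge, Pi.single_apply,
      depotEdge_inj, Pi.one_apply, depotEdge_ne_targetEdge]
    grind
  have ht (i j : T) (h' : i ≠ j) :
      (loops 1 (fun _ => d₀) + exchange d₀ (targetEdge h) : Edge T D → ℝ) (targetEdge h') =
        if targetEdge (D := D) h' = targetEdge h then 1 else 0 := by
    simp [exchange_targetEdge, Pi.single_apply]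
  refine .of_one_targetEdge h d₀ (fun e => ?_) (fun i => ?_) (by simp [ht]) (fun i j h' hne => ?_)
    (fun v d => ?_) (fun d => by simp [hd]) (fun d => by simp [hd])
  · rcases edge_cases e with ⟨v, d, rfl⟩ | ⟨i, j, h, rfl⟩
    · rw [hd]; split_ifs <;> norm_num
    · rw [ht]; split_ifs <;> norm_num
  · rw [total_add, total_loops, total_exchange]; simp
  · rw [ht, if_neg hne]
  · rw [hd]; split_ifs <;> simp

/-! ### The affine hull -/

/-- The homogeneous linear system defining the direction of the affine hull of `P(F)`: the degree
equations, and `y v = 0` for the targets `v` in `U`. -/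
noncomputable def system (D : Type*) [Fintype D] [DecidableEq D] (U : Finset T) :
    (Edge T D → ℝ) × (T → ℝ) →ₗ[ℝ] (T → ℝ) × (U → ℝ) where
  toFun p := (fun i => total p.1 (delta {Sum.inl i}) - 2 * p.2 i, fun v => p.2 v)
  map_add' p q := by
    ext i
    · simp [total_add]; ring
    · simp
  map_smul' c p := by
    ext i
    · simp [total_smul]; ring
    · simp

theorem mem_ker_system {U : Finset T} {p : (Edge T D → ℝ) × (T → ℝ)} :
    p ∈ LinearMap.ker (system D U) ↔
      (∀ i, total p.1 (delta {Sum.inl i}) = 2 * p.2 i) ∧ ∀ v ∈ U, p.2 v = 0 := by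
  simp [system, funext_iff, sub_eq_zero]

theorem system_surjective [Nonempty D] (U : Finset T) : Function.Surjective (system D U) := by
  rintro ⟨a, b⟩
  let d₀ : D := Classical.arbitrary D
  let y : T → ℝ := fun v => if h : v ∈ U then b ⟨v, h⟩ else 0
  -- Loops double their weight in the degree, so `a v / 2` creates the defect `a v`.
  refine ⟨(loops (fun v => y v + a v / 2) fun _ => d₀, y), ?_⟩
  ext i
  · simp [system, total_loops]; ring
  · simp [system, y]

theorem finrank_ker_system [Nonempty D] (U : Finset T) :
    (Module.finrank ℝ (LinearMap.ker (system D U)) : ℤ) =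
      ((Fintype.card T).choose 2 : ℤ) + (Fintype.card T : ℤ) * (Fintype.card D : ℤ) - U.card := by
  have h := LinearMap.finrank_range_add_finrank_ker (system D U)
  rw [LinearMap.range_eq_top.mpr (system_surjective U), finrank_top] at h
  simp only [Module.finrank_prod, Module.finrank_fintype_fun_eq_card, Fintype.card_coe] at h
  have := card_edge (T := T) (D := D)
  omega

/-- Summing the exchanges with weights `p.1 e` reproduces `p.1`, except that each edge from `v` to
`d₀` loses the degree of `v`, which is `2 * p.2 v`; the second sum restores it. -/
theorem eq_sum_exchange (d₀ : D) {p : (Edge T D → ℝ) × (T → ℝ)}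
    (hp : ∀ i, total p.1 (delta {Sum.inl i}) = 2 * p.2 i) :
    p = ∑ e, p.1 e • (exchange d₀ e, (0 : T → ℝ)) +
      ∑ v, p.2 v • ((Pi.single (depotEdge v d₀) 2 : Edge T D → ℝ), (Pi.single v 1 : T → ℝ)) := by
  have h1 : ∑ e, p.1 e • exchange d₀ e =
      p.1 - ∑ v, (2 * p.2 v) • (Pi.single (depotEdge v d₀) 1 : Edge T D → ℝ) := by
    simp only [exchange, smul_sub, Finset.sum_sub_distrib, Finset.smul_sum]
    congr 1
    · ext e
      simp [Pi.single_apply]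
    · rw [Finset.sum_comm]
      refine Finset.sum_congr rfl fun v _ => ?_
      simp only [← hp, total, Finset.sum_smul, smul_ite, smul_zero, ← Finset.sum_filter]
      congr 1
      ext e
      simp [mem_delta_singleton]
  refine Prod.ext ?_ ?_
  · simp only [Prod.fst_add, Prod.fst_sum, Prod.smul_fst, h1]
    ext e
    simp [Pi.single_apply]
    simp [Finset.sum_ite, mul_comm]
  · ext v
    simp [Prod.snd_sum, Pi.single_apply]

/-! ### The vector span of `PF`. -/

variable {C : Finpartition (Finset.univ : Finset T)} {F : Finset T}

/-- Integrality is used only at feasible points; the resulting equations are affine and pass to the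
convex hull. -/
theorem degree_and_visit_of_mem_PF {p : (Edge T D → ℝ) × (T → ℝ)} (hp : p ∈ PF D C F) :
    (∀ i, total p.1 (delta {Sum.inl i}) = 2 * p.2 i) ∧ ∀ v ∈ F ∪ W C, p.2 v = 1 := by
  have hP : p ∈ {q : (Edge T D → ℝ) × (T → ℝ) |
      (∀ i, total q.1 (delta {Sum.inl i}) = 2 * q.2 i) ∧ ∀ v ∈ W C, q.2 v = 1} := by
    refine convexHull_min ?_ ?_ hp.1
    · refine fun q hq => ⟨hq.degree, fun v hv => ?_⟩
      obtain ⟨w, hw⟩ := Finset.card_eq_one.mp (Finset.mem_filter.mp hv).2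
      have hvw : v = w := by
        have := C.mem_part (Finset.mem_univ v)
        rwa [hw, Finset.mem_singleton] at this
      have h := hq.assignment (C.part v) (C.part_mem.mpr (Finset.mem_univ v))
      rw [hw, Finset.sum_singleton, ← hvw] at h
      rcases hq.integer_visit v with h' | h'
      · linarith
      · exact h'
    · intro q hq r hr s t _ _ hst
      refine ⟨fun i => ?_, fun v hv => ?_⟩
      · simp only [Prod.fst_add, Prod.smul_fst, total_add, total_smul, hq.1, hr.1, Prod.snd_add,
          Prod.smul_snd, Pi.add_apply, Pi.smul_apply, smul_eq_mul]
        ring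
      · simp [hq.2 v hv, hr.2 v hv, hst]
  refine ⟨hP.1, fun v hv => ?_⟩
  rcases Finset.mem_union.mp hv with h | h
  · exact hp.2 v h
  · exact hP.2 v h

theorem Feasible.mem_PF {x : Edge T D → ℝ} {y : T → ℝ} (h : Feasible C x y)
    (hF : ∀ v ∈ F, y v = 1) : (x, y) ∈ PF D C F :=
  ⟨subset_convexHull ℝ _ h, hF⟩

theorem loops_one_mem_PF (f : T → D) : (loops 1 f, (1 : T → ℝ)) ∈ PF D C F := by
  refine (feasible_loops f (fun c hc => ?_) fun _ => Or.inr rfl).mem_PF fun _ _ => rfl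
  have := Finset.card_pos.mpr (C.nonempty_of_mem_parts hc)
  simpa using Nat.one_le_iff_ne_zero.mpr this.ne'

theorem exchange_mem_vectorSpan (d₀ : D) (e : Edge T D) :
    (exchange d₀ e, (0 : T → ℝ)) ∈ vectorSpan ℝ (PF D C F) := by
  have h₀ := loops_one_mem_PF (C := C) (F := F) fun _ => d₀
  rcases edge_cases e with ⟨v, d, rfl⟩ | ⟨a, b, h, rfl⟩
  · have h := vsub_mem_vectorSpan ℝ
      (loops_one_mem_PF (C := C) (F := F) (Function.update (fun _ => d₀) v d)) h₀
    -- Moving a loop shifts two units from one depot edge to the other, hence the half.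
    convert Submodule.smul_mem _ (1 / 2 : ℝ) h using 1
    refine Prod.ext ?_ (by simp)
    ext e
    rcases edge_cases e with ⟨w, d', rfl⟩ | ⟨a, b, h, rfl⟩
    · by_cases hw : w = v
      · subst hw
        simp [exchange_depotEdge, Pi.single_apply]
        grind
      · simp [exchange_depotEdge, hw]
    · simp [exchange_depotEdge]
  · have h := vsub_mem_vectorSpan ℝ
      ((feasible_targetEdge C d₀ h).mem_PF (F := F) fun _ _ => rfl) h₀
    simpa using h

theorem visit_mem_vectorSpan (d₀ : D) {v : T} (hv : v ∉ F ∪ W C) :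
    ((Pi.single (depotEdge v d₀) 2 : Edge T D → ℝ), (Pi.single v 1 : T → ℝ)) ∈
      vectorSpan ℝ (PF D C F) := by
  have h₀ := loops_one_mem_PF (C := C) (F := F) fun _ => d₀
  simp only [Finset.mem_union, not_or] at hv
  have hf : Feasible C (loops (Function.update 1 v 0) fun _ => d₀) (Function.update 1 v 0) := by
    refine feasible_loops _ (fun c hc => ?_) fun i => ?_
    -- As `v ∉ W C`, every cluster keeps a visited target after `v` is dropped.
    · obtain ⟨w, hw, hwv⟩ : ∃ w ∈ c, w ≠ v := by
        by_contra! hc'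
        have hcv : c = {v} :=
          Finset.eq_singleton_iff_nonempty_unique_mem.mpr ⟨C.nonempty_of_mem_parts hc, hc'⟩
        have hp : C.part v = c := C.part_eq_of_mem hc (by simp [hcv])
        exact hv.2 (by simp [W, hp, hcv])
      have := Finset.single_le_sum (f := (Function.update 1 v 0 : T → ℝ)) (fun i _ => by
        by_cases hi : i = v <;> simp [hi]) hw
      simpa [hwv] using this
    · by_cases hi : i = v <;> simp [hi]
  have h := vsub_mem_vectorSpan ℝ h₀ (hf.mem_PF (F := F) fun w hw => by
    have : w ≠ v := fun h => hv.1 (h ▸ hw)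
    simp [this])
  convert h using 1
  refine Prod.ext ?_ ?_
  · ext e
    rcases edge_cases e with ⟨w, d', rfl⟩ | ⟨a, b, h, rfl⟩
    · by_cases hw : w = v <;> simp [Pi.single_apply, hw]
    · simp
  · ext w
    by_cases hw : w = v <;> simp [hw]

theorem vectorSpan_PF [Nonempty D] :
    vectorSpan ℝ (PF D C F) = LinearMap.ker (system D (F ∪ W C)) := by
  apply le_antisymm
  · rw [vectorSpan_def, Submodule.span_le]
    rintro _ ⟨p, hp, q, hq, rfl⟩
    have hp := degree_and_visit_of_mem_PF hp
    have hq := degree_and_visit_of_mem_PF hq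
    refine mem_ker_system.mpr ⟨fun i => ?_, fun v hv => ?_⟩
    · simp only [vsub_eq_sub, Prod.fst_sub, total_sub, hp.1, hq.1, Prod.snd_sub, Pi.sub_apply]
      ring
    · simp [hp.2 v hv, hq.2 v hv]
  · intro p hp
    rw [mem_ker_system] at hp
    rw [eq_sum_exchange (Classical.arbitrary D) hp.1]
    refine add_mem (sum_mem fun e _ => Submodule.smul_mem _ _ (exchange_mem_vectorSpan _ e))
      (sum_mem fun v _ => ?_)
    by_cases hv : v ∈ F ∪ W C
    · simp [hp.2 v hv]
    · exact Submodule.smul_mem _ _ (visit_mem_vectorSpan _ hv)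

end

end GMDTSP

theorem lemma1 {T D : Type*} [Fintype T] [DecidableEq T] [Fintype D] [DecidableEq D]
    [Nonempty D] (C : Finpartition (Finset.univ : Finset T)) (F : Finset T) :
    GMDTSP.dim (GMDTSP.PF D C F) =
      ((Fintype.card T).choose 2 : ℤ) + (Fintype.card T : ℤ) * (Fintype.card D : ℤ)
        - ((F ∪ GMDTSP.W C).card : ℤ) := by
  -- Visiting all targets is feasible for every `F`, so the value `-1` never occurs.
  have hne : GMDTSP.PF D C F ≠ ∅ :=
    Set.nonempty_iff_ne_empty.mp ⟨_, GMDTSP.loops_one_mem_PF fun _ => Classical.arbitrary D⟩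
  rw [GMDTSP.dim, if_neg hne, direction_affineSpan, GMDTSP.vectorSpan_PF,
    GMDTSP.finrank_ker_system]
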